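/- Let $(X,T)$ be a topological dynamical system, that is, $X$ is a compact metric space and $T:X\to X$ is a continuous surjection. Let $K(X)$ be the space of all non-empty closed subsets of $X$ with the Hausdorff metric, and let $T_K:K(X)\to K(X)$ be the induced map $T_K(C)=TC$. A system $(Y,S)$ is called transitive if for all non-empty open sets $U,V\subset Y$ the set $\{n\ge 0: S^{-n}V\cap U\neq\emptyset\}$ is infinite; it is called weakly mixing if $(Y\times Y,S\times S)$ is transitive; and it is called an $E$-system if it is transitive and there is an $S$-invariant Borel probability measure $\mu$ on $Y$ with full support, i.e. $\operatorname{supp}(\mu)=Y$. Then $(X,T)$ is a weakly mixing $E$-system if and only if $(K(X),T_K)$ is an $E$-system. -/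

import Mathlib

open Set Function MeasureTheory TopologicalSpace

namespace TopDyn

/-- The set `N(U, V)` of all times `n ≥ 0` with `T⁻ⁿ V ∩ U ≠ ∅`. -/
def hittingTimes {Y : Type*} (T : Y → Y) (U V : Set Y) : Set ℕ :=
  {n : ℕ | (T^[n] ⁻¹' V ∩ U).Nonempty}

/-- Transitivity: `N(U, V)` is infinite for each pair of non-empty open sets `U`, `V`. -/
def IsTransitive {Y : Type*} [TopologicalSpace Y] (T : Y → Y) : Prop :=
  ∀ U V : Set Y, IsOpen U → U.Nonempty → IsOpen V → V.Nonempty → (hittingTimes T U V).Infinite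

/-- Weak mixing: the product system `(Y × Y, T × T)` is transitive. -/
def IsWeaklyMixing {Y : Type*} [TopologicalSpace Y] (T : Y → Y) : Prop :=
  IsTransitive (Prod.map T T : Y × Y → Y × Y)

/-- `E`-system: transitive, with an invariant Borel probability measure of full support. -/
def IsESystem {Y : Type*} [TopologicalSpace Y] [MeasurableSpace Y] [BorelSpace Y]
    (T : Y → Y) : Prop :=
  IsTransitive T ∧
    ∃ μ : Measure Y, IsProbabilityMeasure μ ∧ MeasurePreserving T μ μ ∧ μ.support = univ

/-- The map `T_K(C) = T C` induced by `T` on the space of non-empty compact subsets with the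
Hausdorff metric; in a compact metric space these are exactly the non-empty closed subsets. -/
def hyperspaceMap {X : Type*} [TopologicalSpace X] (T : X → X) (hT : Continuous T) :
    NonemptyCompacts X → NonemptyCompacts X :=
  NonemptyCompacts.map T hT

end TopDyn

/-! Finite sets are dense in the hyperspace, so transitivity of `T_K` amounts to simultaneous
hitting of finitely many pairs of open sets, i.e. weak mixing of all orders, which weak mixing
already gives. Measures go up by taking the law of a random finite set of independent points. They
come down by Hahn–Banach: `p f = ∫ max_C f dμ(C)` is sublinear and `T`-invariant, so it dominates an
invariant linear functional, and Riesz turns that into a measure. The bound `∫ min_C f dμ(C) ≤ Λ f`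
then makes it a probability measure of full support. -/

namespace TopDyn

/-! ### Hitting times and weak mixing of higher order -/

section Hitting

variable {Y : Type*} {T : Y → Y}

theorem mem_hittingTimes {U V : Set Y} {n : ℕ} :
    n ∈ hittingTimes T U V ↔ ∃ x ∈ U, T^[n] x ∈ V :=
  ⟨fun ⟨x, hV, hU⟩ => ⟨x, hU, hV⟩, fun ⟨x, hU, hV⟩ => ⟨x, hV, hU⟩⟩

theorem mem_hittingTimes_prod {U₁ U₂ V₁ V₂ : Set Y} {n : ℕ} :
    n ∈ hittingTimes (Prod.map T T) (U₁ ×ˢ U₂) (V₁ ×ˢ V₂) ↔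
      n ∈ hittingTimes T U₁ V₁ ∧ n ∈ hittingTimes T U₂ V₂ := by
  simp only [mem_hittingTimes, Prod.map_iterate]
  constructor
  · rintro ⟨⟨x, y⟩, ⟨hx, hy⟩, hx', hy'⟩
    exact ⟨⟨x, hx, hx'⟩, y, hy, hy'⟩
  · rintro ⟨⟨x, hx, hx'⟩, y, hy, hy'⟩
    exact ⟨(x, y), ⟨hx, hy⟩, hx', hy'⟩

variable [TopologicalSpace Y]

theorem isWeaklyMixing_iff :
    IsWeaklyMixing T ↔ ∀ U₁ U₂ V₁ V₂ : Set Y, IsOpen U₁ → U₁.Nonempty → IsOpen U₂ → U₂.Nonempty →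
      IsOpen V₁ → V₁.Nonempty → IsOpen V₂ → V₂.Nonempty →
      (hittingTimes T U₁ V₁ ∩ hittingTimes T U₂ V₂).Infinite := by
  constructor
  · intro h U₁ U₂ V₁ V₂ oU₁ nU₁ oU₂ nU₂ oV₁ nV₁ oV₂ nV₂
    refine (h _ _ (oU₁.prod oU₂) (nU₁.prod nU₂) (oV₁.prod oV₂) (nV₁.prod nV₂)).mono ?_
    exact fun n hn => mem_hittingTimes_prod.1 hn
  · intro h U V oU nU oV nV
    obtain ⟨⟨a, b⟩, hab⟩ := nU
    obtain ⟨⟨c, d⟩, hcd⟩ := nV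
    obtain ⟨U₁, U₂, oU₁, oU₂, ha, hb, hU⟩ := isOpen_prod_iff.1 oU a b hab
    obtain ⟨V₁, V₂, oV₁, oV₂, hc, hd, hV⟩ := isOpen_prod_iff.1 oV c d hcd
    refine (h U₁ U₂ V₁ V₂ oU₁ ⟨a, ha⟩ oU₂ ⟨b, hb⟩ oV₁ ⟨c, hc⟩ oV₂ ⟨d, hd⟩).mono ?_
    intro n hn
    obtain ⟨x, hx, hx'⟩ := mem_hittingTimes.1 (mem_hittingTimes_prod.2 hn)
    exact mem_hittingTimes.2 ⟨x, hU hx, hV hx'⟩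

theorem IsWeaklyMixing.isTransitive (h : IsWeaklyMixing T) : IsTransitive T :=
  fun U V oU nU oV nV =>
    (isWeaklyMixing_iff.1 h U U V V oU nU oU nU oV nV oV nV).mono inter_subset_left

/-- To check weak mixing it suffices to hit two open sets simultaneously from a single one. -/
theorem isWeaklyMixing_of_infinite_inter (hT : Continuous T) (hsurj : Surjective T)
    (h : ∀ U V₁ V₂ : Set Y, IsOpen U → U.Nonempty → IsOpen V₁ → V₁.Nonempty →
      IsOpen V₂ → V₂.Nonempty → (hittingTimes T U V₁ ∩ hittingTimes T U V₂).Infinite) :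
    IsWeaklyMixing T := by
  rw [isWeaklyMixing_iff]
  intro U₁ U₂ V₁ V₂ oU₁ nU₁ oU₂ nU₂ oV₁ nV₁ oV₂ nV₂
  obtain ⟨n, hn, -⟩ := (h U₁ U₂ U₂ oU₁ nU₁ oU₂ nU₂ oU₂ nU₂).nonempty
  obtain ⟨x, hx, hx'⟩ := mem_hittingTimes.1 hn
  -- If `z` starts in this intersection and `T^k z` lies in `T⁻ⁿ V₂`, then `T^n z` is a point of
  -- `U₂` that reaches `V₂` at time `k`.
  refine (h (U₁ ∩ T^[n] ⁻¹' U₂) V₁ (T^[n] ⁻¹' V₂) (oU₁.inter (oU₂.preimage (hT.iterate n)))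
    ⟨x, hx, hx'⟩ oV₁ nV₁ (oV₂.preimage (hT.iterate n))
    (nV₂.preimage (hsurj.iterate n))).mono ?_
  rintro k ⟨hk₁, hk₂⟩
  obtain ⟨y, hy, hy'⟩ := mem_hittingTimes.1 hk₁
  obtain ⟨z, hz, hz'⟩ := mem_hittingTimes.1 hk₂
  refine ⟨mem_hittingTimes.2 ⟨y, hy.1, hy'⟩, mem_hittingTimes.2 ⟨T^[n] z, hz.2, ?_⟩⟩
  rwa [← iterate_add_apply, add_comm, iterate_add_apply]

/-- The sets of hitting times of a weakly mixing map form a filter base. -/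
theorem IsWeaklyMixing.exists_hittingTimes_subset_inter (hT : Continuous T)
    (h : IsWeaklyMixing T) {U₁ U₂ V₁ V₂ : Set Y} (oU₁ : IsOpen U₁) (nU₁ : U₁.Nonempty)
    (oU₂ : IsOpen U₂) (nU₂ : U₂.Nonempty) (oV₁ : IsOpen V₁) (nV₁ : V₁.Nonempty)
    (oV₂ : IsOpen V₂) (nV₂ : V₂.Nonempty) :
    ∃ U V : Set Y, IsOpen U ∧ U.Nonempty ∧ IsOpen V ∧ V.Nonempty ∧
      hittingTimes T U V ⊆ hittingTimes T U₁ V₁ ∩ hittingTimes T U₂ V₂ := by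
  obtain ⟨n, hU, hV⟩ :=
    (isWeaklyMixing_iff.1 h U₁ V₁ U₂ V₂ oU₁ nU₁ oV₁ nV₁ oU₂ nU₂ oV₂ nV₂).nonempty
  obtain ⟨x, hx, hx'⟩ := mem_hittingTimes.1 hU
  obtain ⟨y, hy, hy'⟩ := mem_hittingTimes.1 hV
  -- Furstenberg's trick: one `n` carries part of `U₁` into `U₂` and part of `V₁` into `V₂`, so an
  -- orbit segment between these parts shadows, shifted by `n`, one from `U₂` to `V₂`.
  refine ⟨U₁ ∩ T^[n] ⁻¹' U₂, V₁ ∩ T^[n] ⁻¹' V₂, oU₁.inter (oU₂.preimage (hT.iterate n)),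
    ⟨x, hx, hx'⟩, oV₁.inter (oV₂.preimage (hT.iterate n)), ⟨y, hy, hy'⟩, fun k hk => ?_⟩
  obtain ⟨z, hz, hz'⟩ := mem_hittingTimes.1 hk
  refine ⟨mem_hittingTimes.2 ⟨z, hz.1, hz'.1⟩, mem_hittingTimes.2 ⟨T^[n] z, hz.2, ?_⟩⟩
  rw [← iterate_add_apply, add_comm, iterate_add_apply]
  exact hz'.2

/-- A weakly mixing map is weakly mixing of all orders. -/
theorem IsWeaklyMixing.infinite_iInter_hittingTimes (hT : Continuous T) (h : IsWeaklyMixing T)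
    {ι : Type*} [Finite ι] [Nonempty ι] {U V : ι → Set Y} (oU : ∀ i, IsOpen (U i))
    (nU : ∀ i, (U i).Nonempty) (oV : ∀ i, IsOpen (V i)) (nV : ∀ i, (V i).Nonempty) :
    (⋂ i, hittingTimes T (U i) (V i)).Infinite := by
  have key : ∀ s : Finset ι, s.Nonempty → ∃ U' V' : Set Y, IsOpen U' ∧ U'.Nonempty ∧ IsOpen V' ∧
      V'.Nonempty ∧ hittingTimes T U' V' ⊆ ⋂ i ∈ s, hittingTimes T (U i) (V i) := by
    intro s hs
    induction hs using Finset.Nonempty.cons_induction with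
    | singleton i => exact ⟨U i, V i, oU i, nU i, oV i, nV i, by simp⟩
    | cons i s hi hs ih =>
      obtain ⟨U', V', oU', nU', oV', nV', hsub⟩ := ih
      obtain ⟨U'', V'', oU'', nU'', oV'', nV'', hsub'⟩ :=
        h.exists_hittingTimes_subset_inter hT (oU i) (nU i) oU' nU' (oV i) (nV i) oV' nV'
      refine ⟨U'', V'', oU'', nU'', oV'', nV'', fun n hn => ?_⟩
      have hn' := hsub (hsub' hn).2
      simp only [mem_iInter, Finset.mem_cons, forall_eq_or_imp] at hn' ⊢
      exact ⟨(hsub' hn).1, hn'⟩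
  have := Fintype.ofFinite ι
  obtain ⟨U', V', oU', nU', oV', nV', hsub⟩ := key Finset.univ Finset.univ_nonempty
  exact (h.isTransitive U' V' oU' nU' oV' nV').mono (by simpa using hsub)

end Hitting

section Measures

variable {Y : Type*} [TopologicalSpace Y] [MeasurableSpace Y]

theorem isOpenPosMeasure_iff_support_eq_univ {μ : Measure Y} :
    μ.IsOpenPosMeasure ↔ μ.support = univ := by
  refine ⟨fun _ => Measure.support_eq_univ, fun h => ⟨fun U hU ⟨x, hx⟩ => ?_⟩⟩
  exact ((Measure.mem_support_iff_forall x).1 (h ▸ mem_univ x) U (hU.mem_nhds hx)).ne'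

end Measures

/-! ### Transitivity of the hyperspace map -/

section Hyperspace

variable {X : Type*} [TopologicalSpace X] {T : X → X}

theorem coe_hyperspaceMap_iterate (hT : Continuous T) (n : ℕ) (C : NonemptyCompacts X) :
    (((hyperspaceMap T hT)^[n] C : NonemptyCompacts X) : Set X) = T^[n] '' C := by
  induction n with
  | zero => simp
  | succ n ih =>
    rw [iterate_succ_apply', iterate_succ', image_comp, ← ih]
    rfl

/-- A closed set inside `U` whose image meets both `V₁` and `V₂` provides points of `U` reaching
each of them at the same time. -/
theorem isWeaklyMixing_of_hyperspaceMap (hT : Continuous T) (hsurj : Surjective T)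
    (h : IsTransitive (hyperspaceMap T hT)) : IsWeaklyMixing T := by
  refine isWeaklyMixing_of_infinite_inter hT hsurj ?_
  rintro U V₁ V₂ oU ⟨x, hx⟩ oV₁ ⟨y, hy⟩ oV₂ ⟨z, hz⟩
  refine (h {C | (C : Set X) ⊆ U} ({C | ((C : Set X) ∩ V₁).Nonempty} ∩
    {C | ((C : Set X) ∩ V₂).Nonempty}) (NonemptyCompacts.isOpen_subsets_of_isOpen oU)
    ⟨{x}, by simpa using hx⟩
    ((NonemptyCompacts.isOpen_inter_nonempty_of_isOpen oV₁).inter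
      (NonemptyCompacts.isOpen_inter_nonempty_of_isOpen oV₂))
    ⟨{y} ⊔ {z}, ⟨y, by simp, hy⟩, ⟨z, by simp, hz⟩⟩).mono ?_
  intro n hn
  obtain ⟨C, hC, hC₁, hC₂⟩ := mem_hittingTimes.1 hn
  simp only [mem_ofPred_eq, coe_hyperspaceMap_iterate] at hC hC₁ hC₂
  obtain ⟨_, ⟨a, ha, rfl⟩, ha'⟩ := hC₁
  obtain ⟨_, ⟨b, hb, rfl⟩, hb'⟩ := hC₂
  exact ⟨mem_hittingTimes.2 ⟨a, hC ha, ha'⟩, mem_hittingTimes.2 ⟨b, hC hb, hb'⟩⟩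

/-- The finite set of values of a tuple, as a point of the hyperspace. -/
def finiteRange {ι : Type*} [Finite ι] [Nonempty ι] (x : ι → X) : NonemptyCompacts X :=
  ⟨⟨range x, (finite_range x).isCompact⟩, range_nonempty x⟩

section FiniteRange

variable {ι : Type*} [Finite ι] [Nonempty ι]

@[simp]
theorem coe_finiteRange (x : ι → X) : (finiteRange x : Set X) = range x := rfl

theorem continuous_finiteRange : Continuous (finiteRange : (ι → X) → NonemptyCompacts X) :=
  letI := TopologicalSpace.vietoris X
  NonemptyCompacts.isEmbedding_coe.continuous_iff.2 vietoris.continuous_range_of_finite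

theorem hyperspaceMap_iterate_finiteRange (hT : Continuous T) (n : ℕ) (x : ι → X) :
    (hyperspaceMap T hT)^[n] (finiteRange x) = finiteRange fun i => T^[n] (x i) := by
  apply NonemptyCompacts.ext
  rw [coe_hyperspaceMap_iterate, coe_finiteRange, coe_finiteRange, ← range_comp]
  rfl

theorem exists_finiteRange_mem {𝒰 : Set (NonemptyCompacts X)} (h : IsOpen 𝒰)
    (hne : 𝒰.Nonempty) : ∃ (n : ℕ) (x : Fin (n + 1) → X), finiteRange x ∈ 𝒰 := by
  obtain ⟨C, hC, hfin⟩ := NonemptyCompacts.dense_setOfPred_finite.inter_open_nonempty 𝒰 h hne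
  obtain ⟨n, x, -, hx⟩ := (show (C : Set X).Finite from hfin).fin_param
  obtain _ | n := n
  · have := C.nonempty
    simp [← hx] at this
  · exact ⟨n, x, by rwa [show finiteRange x = C from NonemptyCompacts.ext hx]⟩

theorem exists_box_of_finiteRange_mem {𝒰 : Set (NonemptyCompacts X)} (h : IsOpen 𝒰) {x : ι → X}
    (hx : finiteRange x ∈ 𝒰) : ∃ U : ι → Set X, (∀ i, IsOpen (U i)) ∧ (∀ i, x i ∈ U i) ∧
      ∀ y : ι → X, (∀ i, y i ∈ U i) → finiteRange y ∈ 𝒰 := by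
  have := Fintype.ofFinite ι
  obtain ⟨U, hU, hsub⟩ := isOpen_pi_iff'.1 (h.preimage continuous_finiteRange) x hx
  exact ⟨U, fun i => (hU i).1, fun i => (hU i).2, fun y hy => hsub fun i _ => hy i⟩

end FiniteRange

theorem IsWeaklyMixing.isTransitive_hyperspaceMap (hT : Continuous T) (h : IsWeaklyMixing T) :
    IsTransitive (hyperspaceMap T hT) := by
  intro 𝒰 𝒱 o𝒰 n𝒰 o𝒱 n𝒱
  obtain ⟨m, x, hx⟩ := exists_finiteRange_mem o𝒰 n𝒰
  obtain ⟨n, y, hy⟩ := exists_finiteRange_mem o𝒱 n𝒱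
  -- Repeating points leaves a finite set unchanged, so both tuples can be pulled back to a common
  -- index set.
  let ι := Fin (m + 1) × Fin (n + 1)
  have hx' : finiteRange (fun i : ι => x i.1) ∈ 𝒰 := by
    convert hx using 1
    exact NonemptyCompacts.ext (Prod.fst_surjective.range_comp x)
  have hy' : finiteRange (fun i : ι => y i.2) ∈ 𝒱 := by
    convert hy using 1
    exact NonemptyCompacts.ext (Prod.snd_surjective.range_comp y)
  obtain ⟨U, oU, hU, hU'⟩ := exists_box_of_finiteRange_mem o𝒰 hx'
  obtain ⟨V, oV, hV, hV'⟩ := exists_box_of_finiteRange_mem o𝒱 hy'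
  refine (h.infinite_iInter_hittingTimes hT oU (fun i => ⟨_, hU i⟩) oV
    (fun i => ⟨_, hV i⟩)).mono fun k hk => ?_
  choose z hz hz' using fun i => mem_hittingTimes.1 (mem_iInter.1 hk i)
  refine mem_hittingTimes.2 ⟨finiteRange z, hU' z hz, ?_⟩
  rw [hyperspaceMap_iterate_finiteRange]
  exact hV' _ hz'

end Hyperspace

/-! ### Lifting an invariant measure to the hyperspace -/

section HyperspaceMeasure

variable {X : Type*} [TopologicalSpace X] [SecondCountableTopology X]
  [MeasurableSpace X] [BorelSpace X]
  [MeasurableSpace (NonemptyCompacts X)] [BorelSpace (NonemptyCompacts X)] {T : X → X}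

/-- The distribution of the set of values of `n + 1` independent `μ`-random points. -/
noncomputable def finiteRangeMeasure (μ : Measure X) (n : ℕ) : Measure (NonemptyCompacts X) :=
  (Measure.pi fun _ : Fin (n + 1) => μ).map finiteRange

theorem isProbabilityMeasure_finiteRangeMeasure (μ : Measure X) [IsProbabilityMeasure μ] (n : ℕ) :
    IsProbabilityMeasure (finiteRangeMeasure μ n) :=
  Measure.isProbabilityMeasure_map continuous_finiteRange.measurable.aemeasurable

/-- `finiteRange` intertwines the product map on tuples with `T_K`, so it pushes the invariant
product measure to an invariant one. -/
theorem measurePreserving_finiteRangeMeasure (hT : Continuous T) {μ : Measure X}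
    [IsProbabilityMeasure μ] (h : MeasurePreserving T μ μ) (n : ℕ) :
    MeasurePreserving (hyperspaceMap T hT) (finiteRangeMeasure μ n) (finiteRangeMeasure μ n) := by
  have hK : Measurable (hyperspaceMap T hT) := hT.nonemptyCompacts_map.measurable
  have hpi := measurePreserving_pi (fun _ : Fin (n + 1) => μ) (fun _ => μ) fun _ => h
  refine ⟨hK, ?_⟩
  have hcomp : hyperspaceMap T hT ∘ finiteRange = finiteRange ∘
      fun (x : Fin (n + 1) → X) i => T (x i) :=
    funext fun x => hyperspaceMap_iterate_finiteRange hT 1 x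
  unfold finiteRangeMeasure
  rw [Measure.map_map hK continuous_finiteRange.measurable, hcomp,
    ← Measure.map_map continuous_finiteRange.measurable hpi.measurable, hpi.map_eq]

/-- An invariant probability measure of full support on `X` induces one on the hyperspace. -/
theorem exists_hyperspace_invariant_measure (hT : Continuous T) {μ : Measure X}
    [IsProbabilityMeasure μ] (h : MeasurePreserving T μ μ) [μ.IsOpenPosMeasure] :
    ∃ ν : Measure (NonemptyCompacts X), IsProbabilityMeasure ν ∧
      MeasurePreserving (hyperspaceMap T hT) ν ν ∧ ν.IsOpenPosMeasure := by
  have hprob := isProbabilityMeasure_finiteRangeMeasure μ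
  -- The weights are positive with sum 1; each nonempty open set contains a finite set, hence is
  -- charged by some term.
  refine ⟨Measure.sum fun n => (2⁻¹ : ENNReal) ^ (n + 1) • finiteRangeMeasure μ n,
    ⟨?_⟩, ⟨hT.nonemptyCompacts_map.measurable, ?_⟩, ⟨fun 𝒰 h𝒰 hne h0 => ?_⟩⟩
  · rw [Measure.sum_apply _ MeasurableSet.univ]
    simp only [Measure.smul_apply, measure_univ, smul_eq_mul, mul_one]
    rw [ENNReal.tsum_geometric_add_one, ENNReal.one_sub_inv_two, inv_inv]
    exact ENNReal.inv_mul_cancel two_ne_zero ENNReal.ofNat_ne_top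
  · have hK : Measurable (hyperspaceMap T hT) := hT.nonemptyCompacts_map.measurable
    rw [Measure.map_sum hK.aemeasurable]
    congr 1
    ext1 n
    rw [Measure.map_smul, (measurePreserving_finiteRangeMeasure hT h n).map_eq]
  · rw [Measure.sum_apply _ h𝒰.measurableSet, ENNReal.tsum_eq_zero] at h0
    obtain ⟨n, x, hx⟩ := exists_finiteRange_mem h𝒰 hne
    have h0n := h0 n
    rw [Measure.smul_apply, smul_eq_mul, mul_eq_zero, finiteRangeMeasure,
      Measure.map_apply continuous_finiteRange.measurable h𝒰.measurableSet] at h0n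
    rcases h0n with h0n | h0n
    · simp at h0n
    · exact (h𝒰.preimage continuous_finiteRange).measure_ne_zero _ ⟨x, hx⟩ h0n

end HyperspaceMeasure

/-- The **Riesz–Markov–Kakutani theorem** on a compact space, for real continuous functions. -/
theorem exists_measure_integral_eq {X : Type*} [TopologicalSpace X] [CompactSpace X] [T2Space X]
    [MeasurableSpace X] [BorelSpace X] (Λ : C(X, ℝ) →ₗ[ℝ] ℝ)
    (hΛ : ∀ f : C(X, ℝ), 0 ≤ f → 0 ≤ Λ f) :
    ∃ ν : Measure X, IsFiniteMeasure ν ∧ ∀ f : C(X, ℝ), ∫ x, f x ∂ν = Λ f := by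
  -- By compactness this inclusion is onto: every continuous function has compact support.
  let ι : CompactlySupportedContinuousMap X ℝ →ₗ[ℝ] C(X, ℝ) :=
    { toFun f := f.toContinuousMap
      map_add' _ _ := rfl
      map_smul' _ _ := rfl }
  let Λ' := PositiveLinearMap.mk₀ (Λ ∘ₗ ι) fun f hf => hΛ _ hf
  refine ⟨RealRMK.rieszMeasure Λ', inferInstance, fun f => ?_⟩
  exact RealRMK.integral_rieszMeasure Λ'
    (CompactlySupportedContinuousMap.continuousMapEquiv f)

/-! ### Descending an invariant measure from the hyperspace -/

section SupFunctional

variable {X : Type*} [TopologicalSpace X]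

/-- The maximum of a continuous function over a nonempty compact set. -/
noncomputable def maxOn (f : C(X, ℝ)) (C : NonemptyCompacts X) : ℝ := sSup (f '' C)

theorem maxOn_le_iff {f : C(X, ℝ)} {C : NonemptyCompacts X} {a : ℝ} :
    maxOn f C ≤ a ↔ ∀ x ∈ C, f x ≤ a := by
  rw [maxOn, csSup_le_iff (C.isCompact.image f.continuous).bddAbove (C.nonempty.image f),
    forall_mem_image]
  rfl

theorem le_maxOn (f : C(X, ℝ)) {C : NonemptyCompacts X} {x : X} (hx : x ∈ C) : f x ≤ maxOn f C :=
  maxOn_le_iff.1 le_rfl x hx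

theorem maxOn_add_le (f g : C(X, ℝ)) (C : NonemptyCompacts X) :
    maxOn (f + g) C ≤ maxOn f C + maxOn g C :=
  maxOn_le_iff.2 fun _ hx => add_le_add (le_maxOn f hx) (le_maxOn g hx)

theorem maxOn_smul {c : ℝ} (hc : 0 < c) (f : C(X, ℝ)) (C : NonemptyCompacts X) :
    maxOn (c • f) C = c * maxOn f C := by
  apply le_antisymm
  · exact maxOn_le_iff.2 fun x hx => mul_le_mul_of_nonneg_left (le_maxOn f hx) hc.le
  · rw [← le_div_iff₀' hc]
    refine maxOn_le_iff.2 fun x hx => ?_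
    rw [le_div_iff₀' hc]
    exact le_maxOn (c • f) hx

theorem maxOn_comp {T : X → X} (hT : Continuous T) (f : C(X, ℝ)) (C : NonemptyCompacts X) :
    maxOn (f.comp ⟨T, hT⟩) C = maxOn f (hyperspaceMap T hT C) := by
  rw [maxOn, maxOn, hyperspaceMap, NonemptyCompacts.coe_map, image_image]
  rfl

theorem abs_maxOn_le [CompactSpace X] (f : C(X, ℝ)) (C : NonemptyCompacts X) : |maxOn f C| ≤ ‖f‖ := by
  obtain ⟨x, hx⟩ := C.nonempty
  refine abs_le.2 ⟨(neg_le_of_abs_le (f.norm_coe_le_norm x)).trans (le_maxOn f hx),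
    maxOn_le_iff.2 fun y _ => (le_abs_self _).trans (f.norm_coe_le_norm y)⟩

variable [MeasurableSpace (NonemptyCompacts X)] [BorelSpace (NonemptyCompacts X)]

theorem measurable_maxOn (f : C(X, ℝ)) : Measurable (maxOn f) := by
  refine measurable_of_Iic fun a => ?_
  have : maxOn f ⁻¹' Iic a = {C : NonemptyCompacts X | (C : Set X) ⊆ f ⁻¹' Iic a} :=
    Set.ext fun C => maxOn_le_iff
  rw [this]
  exact (NonemptyCompacts.isClosed_subsets_of_isClosed
    (isClosed_Iic.preimage f.continuous)).measurableSet

variable [CompactSpace X] {μ : Measure (NonemptyCompacts X)} [IsProbabilityMeasure μ]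

theorem integrable_maxOn (f : C(X, ℝ)) : Integrable (maxOn f) μ :=
  .of_bound (measurable_maxOn f).aestronglyMeasurable ‖f‖ (.of_forall (abs_maxOn_le f))

/-- The coboundary operator `g ↦ g - g ∘ T` on continuous functions. -/
noncomputable def coboundary {T : X → X} (hT : Continuous T) : C(X, ℝ) →ₗ[ℝ] C(X, ℝ) :=
  LinearMap.id - (ContinuousMap.compRightAlgHom ℝ ℝ ⟨T, hT⟩).toLinearMap

/-- For an invariant measure `μ` on the hyperspace, the sublinear functional `f ↦ ∫ max f|_C dμ(C)`
dominates a `T`-invariant linear functional. -/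
theorem exists_invariant_linearMap {T : X → X} (hT : Continuous T)
    (h : MeasurePreserving (hyperspaceMap T hT) μ μ) :
    ∃ Λ : C(X, ℝ) →ₗ[ℝ] ℝ, (∀ f : C(X, ℝ), Λ (f.comp ⟨T, hT⟩) = Λ f) ∧
      ∀ f, Λ f ≤ ∫ C, maxOn f C ∂μ := by
  have hadd : ∀ f g : C(X, ℝ), ∫ C, maxOn (f + g) C ∂μ ≤
      ∫ C, maxOn f C ∂μ + ∫ C, maxOn g C ∂μ := fun f g => by
    rw [← integral_add (integrable_maxOn f) (integrable_maxOn g)]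
    exact integral_mono (integrable_maxOn _) ((integrable_maxOn f).add (integrable_maxOn g))
      (maxOn_add_le f g)
  have hcomp : ∀ f : C(X, ℝ), ∫ C, maxOn (f.comp ⟨T, hT⟩) C ∂μ = ∫ C, maxOn f C ∂μ := fun f => by
    simp_rw [maxOn_comp hT f]
    have := integral_map (μ := μ) h.aemeasurable (measurable_maxOn f).aestronglyMeasurable
    rw [← this, h.map_eq]
  -- Hahn–Banach extends the zero functional on coboundaries; it is dominated there since `p g ≤ p
  -- (g - g ∘ T) + p (g ∘ T)` and `p (g ∘ T) = p g`.
  obtain ⟨Λ, hΛ, hle⟩ := exists_extension_of_le_sublinear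
    ⟨LinearMap.range (coboundary hT), 0⟩ (fun f => ∫ C, maxOn f C ∂μ)
    (fun c hc f => by simp_rw [maxOn_smul hc, integral_const_mul]) hadd (by
      rintro ⟨_, g, rfl⟩
      have := hadd (g - g.comp ⟨T, hT⟩) (g.comp ⟨T, hT⟩)
      rw [sub_add_cancel, hcomp] at this
      exact le_of_add_le_add_right ((zero_add _).trans_le this))
  refine ⟨Λ, fun f => ?_, hle⟩
  have : Λ (f - f.comp ⟨T, hT⟩) = 0 := hΛ ⟨_, f, rfl⟩
  rw [map_sub, sub_eq_zero] at this
  exact this.symm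

variable [T2Space X] [MeasurableSpace X] [BorelSpace X]

theorem exists_invariant_measure_of_hyperspace [HasOuterApproxClosed X] {T : X → X}
    (hT : Continuous T) [μ.IsOpenPosMeasure]
    (h : MeasurePreserving (hyperspaceMap T hT) μ μ) :
    ∃ ν : Measure X, IsProbabilityMeasure ν ∧ MeasurePreserving T ν ν ∧ ν.IsOpenPosMeasure := by
  obtain ⟨Λ, hinv, hle⟩ := exists_invariant_linearMap hT h
  -- The left side is the integral of the minimum of `f` over `C`.
  have hge : ∀ f : C(X, ℝ), ∫ C, - maxOn (-f) C ∂μ ≤ Λ f := fun f => by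
    have := hle (-f)
    rw [map_neg] at this
    rw [integral_neg]
    linarith
  obtain ⟨ν, hfin, hν⟩ := exists_measure_integral_eq Λ fun f hf => (integral_nonneg fun C =>
    neg_nonneg.2 (maxOn_le_iff.2 fun x _ => neg_nonpos.2 (hf x))).trans (hge f)
  have hmap : ν.map T = ν := by
    have : IsFiniteMeasure (ν.map T) := inferInstance
    refine ext_of_forall_integral_eq_of_IsFiniteMeasure fun f => ?_
    rw [integral_map hT.measurable.aemeasurable f.continuous.aestronglyMeasurable]
    exact (hν (f.toContinuousMap.comp ⟨T, hT⟩)).trans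
      ((hinv _).trans (hν f.toContinuousMap).symm)
  have hone : Λ 1 = 1 := by
    apply le_antisymm
    · refine (hle 1).trans ((integral_mono (integrable_maxOn 1) (integrable_const 1)
        fun C => maxOn_le_iff.2 fun x _ => le_rfl).trans_eq (by simp))
    · refine le_trans ?_ (hge 1)
      refine le_trans (by simp) (integral_mono (integrable_const (1 : ℝ))
        (integrable_maxOn (-1)).neg fun C => ?_)
      exact le_neg_of_le_neg (maxOn_le_iff.2 fun x _ => le_rfl)
  refine ⟨ν, ⟨?_⟩, ⟨hT.measurable, hmap⟩, ⟨fun U hU ⟨x, hx⟩ h0 => ?_⟩⟩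
  · have := hν 1
    rw [hone] at this
    simpa [measureReal_def, ENNReal.toReal_eq_one_iff] using this
  · obtain ⟨f, hf1, hf0, -, hf⟩ := exists_continuous_one_zero_of_isCompact
      (isCompact_singleton (x := x)) hU.isClosed_compl (by simpa using hx)
    have hΛ0 : Λ f = 0 := by
      rw [← hν]
      refine integral_eq_zero_of_ae ?_
      filter_upwards [compl_mem_ae_iff.2 h0] with y hy using hf0 hy
    -- The sets `C` inside `{f > 1/2}` form a nonempty open family, on which the minimum of `f` is
    -- at least `1/2`.
    have hpos : 0 < ∫ C, - maxOn (-f) C ∂μ := by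
      rw [integral_pos_iff_support_of_nonneg (fun C => neg_nonneg.2 (maxOn_le_iff.2 fun y _ =>
        neg_nonpos.2 (hf y).1)) (integrable_maxOn (-f)).neg]
      refine ((NonemptyCompacts.isOpen_subsets_of_isOpen
        (isOpen_Ioi.preimage f.continuous)).measure_pos μ ⟨{x}, ?_⟩).trans_le
        (measure_mono fun C (hC : (C : Set X) ⊆ f ⁻¹' Ioi (1 / 2)) => ?_)
      · simp [hf1 rfl]
        norm_num
      · have : maxOn (-f) C ≤ -(1 / 2) :=
          maxOn_le_iff.2 fun y hy => neg_le_neg (le_of_lt (hC hy))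
        rw [mem_support]
        linarith
    exact absurd (hge f) (by rw [hΛ0]; exact hpos.not_ge)

end SupFunctional

end TopDyn

theorem theorem3p6 {X : Type*} [MetricSpace X] [CompactSpace X]
    [MeasurableSpace X] [BorelSpace X]
    [MeasurableSpace (NonemptyCompacts X)] [BorelSpace (NonemptyCompacts X)]
    (T : X → X) (hT : Continuous T) (hsurj : Surjective T) :
    (TopDyn.IsWeaklyMixing T ∧ TopDyn.IsESystem T) ↔
      TopDyn.IsESystem (TopDyn.hyperspaceMap T hT) := by
  simp_rw [TopDyn.IsESystem, ← TopDyn.isOpenPosMeasure_iff_support_eq_univ]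
  constructor
  · rintro ⟨hwm, -, μ, _, hμ, _⟩
    exact ⟨hwm.isTransitive_hyperspaceMap hT, TopDyn.exists_hyperspace_invariant_measure hT hμ⟩
  · rintro ⟨htr, μ, _, hμ, _⟩
    have hwm := TopDyn.isWeaklyMixing_of_hyperspaceMap hT hsurj htr
    exact ⟨hwm, hwm.isTransitive, TopDyn.exists_invariant_measure_of_hyperspace hT hμ⟩
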